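/- All graphs are finite and simple. A burning process of a connected graph $G$ is the following: initially all vertices are unburned; in each round $r\ge 1$ one chooses a vertex $x_r$ that is unburned at the end of round $r-1$ (the source of round $r$), and burns $x_r$ together with all unburned vertices that are adjacent to some vertex burned by the end of round $r-1$; burned vertices remain burned, and the process terminates as soon as all vertices are burned. If it terminates in $k$ rounds, $(x_1,\dots,x_k)$ is called a burning sequence of length $k$ for $G$. The burning number $b(G)$ is the minimum length of a burning sequence for $G$. **Proposition.** Let $m$ be a non-negative integer and let $T$ be a tree of order $n\ge m(m+1)+1$ with no vertex of degree 2. Then $$b(T)\le \left\lceil (n-m)^{\frac12}\right\rceil .$$ -/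

import Mathlib

namespace SimpleGraph

variable {V : Type*}

/-- The set of burned vertices after `r` rounds, when the source of round `i + 1` is `x i` (so the
rounds are counted from `1` and the sources are indexed from `0`). In each round, the source of
that round and all neighbours of the already burned vertices become burned, and burned vertices
remain burned. -/
def burned (G : SimpleGraph V) {k : ℕ} (x : Fin k → V) : ℕ → Set V
  | 0 => ∅
  | r + 1 => burned G x r ∪ {v | ∃ u ∈ burned G x r, G.Adj u v} ∪ {v | ∃ i : Fin k, i.val = r ∧ x i = v}

/-- `x` is a burning sequence of length `k` for `G`: every source is unburned when it is chosen, and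
all vertices are burned after `k` rounds. (The process cannot have terminated before round `k`,
since the source of round `k` is unburned after round `k - 1`.) -/
def IsBurningSequence (G : SimpleGraph V) {k : ℕ} (x : Fin k → V) : Prop :=
  (∀ i : Fin k, x i ∉ G.burned x i) ∧ G.burned x k = Set.univ

/-- The burning number: the minimum length of a burning sequence. -/
noncomputable def burningNumber (G : SimpleGraph V) : ℕ :=
  sInf {k | ∃ x : Fin k → V, G.IsBurningSequence x}

theorem burned_mono (G : SimpleGraph V) {k : ℕ} (x : Fin k → V) : Monotone (G.burned x) :=
  monotone_nat_of_le_succ fun _ _ hv => Or.inl (Or.inl hv)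

theorem burned_snoc (G : SimpleGraph V) {k : ℕ} (x : Fin k → V) (w : V) {r : ℕ} (hr : r ≤ k) :
    G.burned (Fin.snoc x w : Fin (k + 1) → V) r = G.burned x r := by
  induction r with
  | zero => rfl
  | succ r ih =>
    have h : {v | ∃ i : Fin (k + 1), i.val = r ∧ (Fin.snoc x w : Fin (k + 1) → V) i = v} =
        {v | ∃ i : Fin k, i.val = r ∧ x i = v} := by
      ext v
      constructor
      · rintro ⟨i, hi, hv⟩
        refine ⟨⟨r, hr⟩, rfl, ?_⟩
        have : i = Fin.castSucc ⟨r, hr⟩ := Fin.ext hi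
        rw [this, Fin.snoc_castSucc] at hv
        exact hv
      · rintro ⟨i, hi, hv⟩
        exact ⟨i.castSucc, hi, by rw [Fin.snoc_castSucc]; exact hv⟩
    rw [burned, burned, ih (by omega), h]

/-- Every finite graph has a burning sequence, so the minimum in `burningNumber` is over a nonempty
set. -/
theorem exists_isBurningSequence [Finite V] (G : SimpleGraph V) :
    ∃ (k : ℕ) (x : Fin k → V), G.IsBurningSequence x := by
  by_contra hcon
  push Not at hcon
  have key : ∀ k : ℕ, ∃ x : Fin k → V, ∀ i : Fin k, x i ∉ G.burned x i := by
    intro k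
    induction k with
    | zero => exact ⟨Fin.elim0, fun i => i.elim0⟩
    | succ k ih =>
      obtain ⟨x, hx⟩ := ih
      have h : G.burned x k ≠ Set.univ := fun h => hcon k x ⟨hx, h⟩
      obtain ⟨w, hw⟩ := (Set.ne_univ_iff_exists_notMem _).1 h
      refine ⟨Fin.snoc x w, fun i => ?_⟩
      rw [burned_snoc G x w (Nat.lt_succ_iff.1 i.2)]
      refine Fin.lastCases ?_ (fun j => ?_) i
      · simpa using hw
      · simpa using hx j
  obtain ⟨x, hx⟩ := key (Nat.card V + 1)
  have hlt : ∀ i j, i < j → x i ≠ x j := by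
    intro i j hij h
    refine hx j (G.burned_mono x (Nat.succ_le_of_lt hij) ?_)
    exact Or.inr ⟨i, rfl, h⟩
  have hinj : Function.Injective x := by
    intro i j h
    rcases lt_trichotomy i j with h' | h' | h'
    · exact absurd h (hlt i j h')
    · exact h'
    · exact absurd h.symm (hlt j i h')
  have := Nat.card_le_card_of_injective x hinj
  simp at this

end SimpleGraph

namespace SimpleGraph

/-! The bound reduces to `n + 1 ≤ k * (k + 1)`. Degree counting makes fewer than half of the
vertices inner, and the inner vertices induce a connected graph. `exists_ball_cover` covers that
graph by balls of radii `0, …, k - 2`: it cuts off deep geodesic cones, each inside one ball, and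
treats the remainder by a median argument. Enlarging every radius by one reaches the leaves, and
balls of radii below `k` yield a burning sequence of length at most `k`. -/

theorem Connected.exists_adj_dist_add_one {V : Type*} {G : SimpleGraph V} (hG : G.Connected)
    {a b : V} (hab : a ≠ b) : ∃ c, G.Adj c b ∧ G.dist a b = G.dist a c + 1 := by
  obtain ⟨p, hp⟩ := hG.exists_walk_length_eq_dist b a
  cases p with
  | nil => exact absurd rfl hab
  | @cons _ c _ h q =>
    refine ⟨c, h.symm, ?_⟩
    have h1 := dist_le q
    have h2 := hG.dist_triangle (u := b) (v := c) (w := a)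
    have h3 : G.dist b c = 1 := dist_eq_one_iff_adj.2 h
    rw [Walk.length_cons] at hp
    rw [dist_comm (u := a) (v := b), dist_comm (u := a) (v := c)]
    omega

theorem Connected.dist_le_add_one_of_adj {V : Type*} {G : SimpleGraph V} (hG : G.Connected)
    (a : V) {b c : V} (h : G.Adj b c) : G.dist a c ≤ G.dist a b + 1 := by
  have h1 := hG.dist_triangle (u := a) (v := b) (w := c)
  rwa [dist_eq_one_iff_adj.2 h] at h1

/-- A set in which every vertex other than a root has a neighbour closer to the root induces a
connected subgraph. -/
theorem induce_connected_of_forall_exists_closer {V : Type*} (G : SimpleGraph V) (S : Set V) (ρ : V)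
    (hρ : ρ ∈ S)
    (h : ∀ w ∈ S, w ≠ ρ → ∃ w' ∈ S, G.Adj w' w ∧ G.dist ρ w' < G.dist ρ w) :
    (G.induce S).Connected := by
  have key : ∀ d, ∀ w : S, G.dist ρ w = d → (G.induce S).Reachable ⟨ρ, hρ⟩ w := by
    intro d
    induction d using Nat.strong_induction_on with
    | _ d ih =>
      rintro ⟨w, hw⟩ hd
      by_cases hwρ : w = ρ
      · subst hwρ
        exact Reachable.refl _
      · obtain ⟨w', hw', hadj, hlt⟩ := h w hw hwρ
        refine (ih _ (hd ▸ hlt) ⟨w', hw'⟩ rfl).trans (Adj.reachable ?_)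
        exact hadj
  have : Nonempty S := ⟨⟨ρ, hρ⟩⟩
  exact ⟨fun a b => (key _ a rfl).symm.trans (key _ b rfl)⟩

theorem dist_le_dist_induce {V : Type*} {G : SimpleGraph V} {S : Set V}
    (hS : (G.induce S).Connected) (a b : S) : G.dist a b ≤ (G.induce S).dist a b := by
  obtain ⟨p, hp⟩ := hS.exists_walk_length_eq_dist a b
  rw [← hp, ← Walk.length_map (Embedding.induce S).toHom p]
  exact dist_le _

/-! ### Geodesic cones and ball covers -/

/-- The vertices that `ρ` can reach by a geodesic through `v`. -/
def geodesicCone {V : Type*} (G : SimpleGraph V) (ρ v : V) : Set V :=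
  {w | G.dist ρ w = G.dist ρ v + G.dist v w}

/-- A geodesic from `ρ` that enters the cone stays in it, so the predecessor of a vertex outside the
cone is outside too. -/
theorem Connected.induce_compl_geodesicCone {V : Type*} {G : SimpleGraph V} (hG : G.Connected)
    {ρ v : V} (h : ρ ≠ v) : (G.induce (G.geodesicCone ρ v)ᶜ).Connected := by
  refine induce_connected_of_forall_exists_closer G _ ρ ?_ ?_
  · have := hG.pos_dist_of_ne h
    simp only [geodesicCone, Set.mem_compl_iff, Set.mem_ofPred_eq, dist_self]
    omega
  · intro w hw hwρ
    obtain ⟨w', hadj, hd⟩ := hG.exists_adj_dist_add_one (Ne.symm hwρ)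
    refine ⟨w', fun hw' => hw ?_, hadj, by omega⟩
    have h1 := hG.dist_le_add_one_of_adj v hadj
    have h2 := hG.dist_triangle (u := ρ) (v := v) (w := w)
    simp only [geodesicCone, Set.mem_ofPred_eq] at hw' ⊢
    omega

/-- Walking back `r` steps along a geodesic from `u` to `ρ` gives a vertex whose geodesic cone
has at least `r + 1` vertices. -/
theorem Connected.exists_lt_ncard_geodesicCone {V : Type*} [Finite V] {G : SimpleGraph V}
    (hG : G.Connected) (ρ u : V) {r : ℕ} (hr : r ≤ G.dist ρ u) :
    ∃ v, G.dist ρ v + r = G.dist ρ u ∧ r < (G.geodesicCone ρ v).ncard := by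
  induction r with
  | zero =>
    exact ⟨u, rfl, (Set.ncard_pos (Set.toFinite _)).2 ⟨u, by simp [geodesicCone]⟩⟩
  | succ r ih =>
    obtain ⟨v, hv, hcard⟩ := ih (by omega)
    have hne : ρ ≠ v := by
      rintro rfl
      rw [dist_self] at hv
      omega
    obtain ⟨v', hadj, hd⟩ := hG.exists_adj_dist_add_one hne
    refine ⟨v', by omega, ?_⟩
    have hlt : (G.geodesicCone ρ v).ncard < (G.geodesicCone ρ v').ncard := by
      refine Set.ncard_lt_ncard ⟨fun w hw => ?_, fun hsub => ?_⟩ (Set.toFinite _)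
      · have h1 := hG.dist_le_add_one_of_adj w hadj.symm
        have h2 := hG.dist_triangle (u := ρ) (v := v') (w := w)
        rw [dist_comm (u := w), dist_comm (u := w)] at h1
        simp only [geodesicCone, Set.mem_ofPred_eq] at hw ⊢
        omega
      · have h1 : v' ∈ G.geodesicCone ρ v := hsub (by simp [geodesicCone])
        simp only [geodesicCone, Set.mem_ofPred_eq] at h1
        omega
    omega

/-- A connected graph of order at most `2 * R + 1` has radius at most `R`; a vertex minimizing the
sum of distances is a possible centre. -/
theorem Connected.exists_forall_dist_le {V : Type*} [Fintype V] {G : SimpleGraph V}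
    (hG : G.Connected) {R : ℕ} (hR : Fintype.card V ≤ 2 * R + 1) :
    ∃ c, ∀ v, G.dist c v ≤ R := by
  classical
  have := hG.nonempty
  obtain ⟨c, hc⟩ := Finite.exists_min fun c => ∑ v, G.dist c v
  refine ⟨c, fun u => ?_⟩
  by_contra! hu
  obtain ⟨c', hc', hcard⟩ :=
    hG.exists_lt_ncard_geodesicCone c u (r := G.dist c u - 1) (by omega)
  have hcc : G.dist c c' = 1 := by omega
  have hadj : G.Adj c c' := dist_eq_one_iff_adj.1 hcc
  let A : Finset V := Finset.univ.filter fun x => x ∈ G.geodesicCone c c'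
  have hA : R + 1 ≤ A.card := by
    have : (G.geodesicCone c c').ncard = A.card := by
      rw [← Set.ncard_coe_finset]
      congr 1
      ext
      simp [A]
    omega
  -- Moving from `c` to `c'` gains one for each vertex of `A` and loses at most one for any other;
  -- as `A` holds more than half of the vertices, this contradicts minimality.
  have h1 : ∑ v, G.dist c' v + 2 * A.card ≤ ∑ v, G.dist c v + Fintype.card V := by
    have e1 : 2 * A.card = ∑ v, if v ∈ A then 2 else 0 := by
      rw [Finset.sum_ite_mem, Finset.univ_inter, Finset.sum_const, smul_eq_mul, mul_comm]
    have e2 : Fintype.card V = ∑ _v : V, 1 := by simp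
    rw [e1, e2, ← Finset.sum_add_distrib, ← Finset.sum_add_distrib]
    refine Finset.sum_le_sum fun v _ => ?_
    have h2 := hG.dist_le_add_one_of_adj v hadj
    rw [dist_comm (u := v), dist_comm (u := v)] at h2
    split_ifs with hv
    · replace hv : G.dist c v = G.dist c c' + G.dist c' v := (Finset.mem_filter.1 hv).2
      omega
    · omega
  have := hc c'
  omega

/-- A connected graph of order at most `s * (s + 1) / 2 + 2 * R + 1` is covered by balls of radii
`0, …, s - 1` and `R`. -/
theorem Connected.exists_ball_cover (s R : ℕ) : ∀ {V : Type*} [Fintype V] {G : SimpleGraph V},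
    G.Connected → 2 * Fintype.card V ≤ s * (s + 1) + 2 * (2 * R + 1) →
    ∃ (c : ℕ → V) (z : V), ∀ v, G.dist z v ≤ R ∨ ∃ i < s, G.dist (c i) v ≤ i := by
  classical
  induction s with
  | zero =>
    intro V _ G hG h
    obtain ⟨z, hz⟩ := hG.exists_forall_dist_le (R := R) (by omega)
    exact ⟨fun _ => z, z, fun v => Or.inl (hz v)⟩
  | succ s ih =>
    intro V _ G hG h
    have := hG.nonempty
    obtain ⟨ρ⟩ := hG.nonempty
    obtain ⟨u, hu⟩ := Finite.exists_max fun u => G.dist ρ u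
    by_cases hs : G.dist ρ u ≤ s
    · exact ⟨fun _ => ρ, ρ, fun v => Or.inr ⟨s, by omega, (hu v).trans hs⟩⟩
    obtain ⟨x, hx, hcard⟩ := hG.exists_lt_ncard_geodesicCone ρ u (r := s) (by omega)
    have hne : ρ ≠ x := by
      rintro rfl
      rw [dist_self] at hx
      omega
    have hconn := hG.induce_compl_geodesicCone hne
    have hcompl := Set.ncard_add_ncard_compl (G.geodesicCone ρ x)
    rw [Nat.card_eq_fintype_card, ← Nat.card_coe_set_eq (G.geodesicCone ρ x)ᶜ,
      Nat.card_eq_fintype_card] at hcompl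
    -- The cone takes away at least `s + 1` vertices, exactly the drop in the bound. It lies within
    -- `s` of `x` since `u` is farthest from `ρ`.
    obtain ⟨c, z, hcz⟩ := ih hconn (by nlinarith)
    refine ⟨fun i => if i = s then x else c i, z, fun v => ?_⟩
    by_cases hv : v ∈ G.geodesicCone ρ x
    · refine Or.inr ⟨s, by omega, ?_⟩
      have := hu v
      simp only [geodesicCone, Set.mem_ofPred_eq] at hv
      simp only [if_true]
      omega
    · obtain h1 | ⟨i, hi, h1⟩ := hcz ⟨v, hv⟩
      · exact Or.inl ((dist_le_dist_induce hconn z ⟨v, hv⟩).trans h1)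
      · refine Or.inr ⟨i, by omega, ?_⟩
        simp only [if_neg hi.ne]
        exact (dist_le_dist_induce hconn _ ⟨v, hv⟩).trans h1

/-! ### From ball covers to burning sequences -/

/-- The planned sources may be replaced by unburned ones whenever they are already burned. -/
theorem Connected.exists_unburned_sources {V : Type*} {G : SimpleGraph V}
    (hG : G.Connected) (y : ℕ → V) {k : ℕ}
    (hk : ∀ r < k, ∀ x : Fin r → V, ¬ G.IsBurningSequence x) :
    ∃ x : Fin k → V, (∀ i : Fin k, x i ∉ G.burned x i) ∧
      ∀ i v, G.dist (y i) v + i < k → v ∈ G.burned x k := by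
  induction k with
  | zero => exact ⟨Fin.elim0, fun i => i.elim0, fun _ _ h => absurd h (Nat.not_lt_zero _)⟩
  | succ k ih =>
    obtain ⟨x, hx, hcov⟩ := ih fun r hr => hk r (by omega)
    have hne : G.burned x k ≠ Set.univ := fun h => hk k (by omega) x ⟨hx, h⟩
    obtain ⟨w, hw, hyw⟩ : ∃ w, w ∉ G.burned x k ∧ (y k ∈ G.burned x k ∨ w = y k) := by
      by_cases hy : y k ∈ G.burned x k
      · obtain ⟨w, hw⟩ := (Set.ne_univ_iff_exists_notMem _).1 hne
        exact ⟨w, hw, Or.inl hy⟩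
      · exact ⟨y k, hy, Or.inr rfl⟩
    refine ⟨Fin.snoc x w, fun i => ?_, fun i v hv => ?_⟩
    · rw [burned_snoc G x w (Nat.lt_succ_iff.1 i.2)]
      refine Fin.lastCases ?_ (fun j => ?_) i
      · simpa using hw
      · simpa using hx j
    · rw [burned, burned_snoc G x w le_rfl]
      by_cases hyv : y i = v
      · subst hyv
        rw [dist_self] at hv
        rcases Nat.lt_or_ge i k with hi | hi
        · exact Or.inl (Or.inl (hcov i _ (by rw [dist_self]; omega)))
        · obtain rfl : i = k := by omega
          rcases hyw with h | rfl
          · exact Or.inl (Or.inl h)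
          · exact Or.inr ⟨Fin.last _, rfl, Fin.snoc_last _ _⟩
      · obtain ⟨u, hadj, hd⟩ := hG.exists_adj_dist_add_one hyv
        exact Or.inl (Or.inr ⟨u, hcov i u (by omega), hadj⟩)

theorem Connected.burningNumber_le_of_ball_cover {V : Type*} {G : SimpleGraph V}
    (hG : G.Connected) {k : ℕ} (c : ℕ → V) (hc : ∀ v, ∃ i < k, G.dist (c i) v ≤ i) :
    G.burningNumber ≤ k := by
  by_contra! hlt
  have hnot : ∀ r ≤ k, ∀ x : Fin r → V, ¬ G.IsBurningSequence x := fun r hr x hx =>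
    absurd (Nat.sInf_le (⟨x, hx⟩ : r ∈ {k | ∃ x : Fin k → V, G.IsBurningSequence x}))
      (not_le.2 (hr.trans_lt hlt))
  -- The source with index `i` has `k - 1 - i` rounds left to spread, so larger balls come first.
  obtain ⟨x, hx, hcov⟩ := hG.exists_unburned_sources (fun i => c (k - 1 - i)) (k := k)
    fun r hr => hnot r hr.le
  refine hnot k le_rfl x ⟨hx, Set.eq_univ_of_forall fun v => ?_⟩
  obtain ⟨i, hi, hd⟩ := hc v
  refine hcov (k - 1 - i) v ?_
  rw [show k - 1 - (k - 1 - i) = i by omega]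
  omega

/-! ### Inner vertices and leaves -/

theorem Connected.exists_adj_degree_ne_one {V : Type*} [Fintype V] {G : SimpleGraph V}
    [DecidableRel G.Adj] (hG : G.Connected) {ρ : V} (hρ : G.degree ρ ≠ 1) {v : V}
    (hne : ρ ≠ v) : ∃ w, G.degree w ≠ 1 ∧ G.Adj w v ∧ G.dist ρ w < G.dist ρ v := by
  obtain ⟨w, hadj, hd⟩ := hG.exists_adj_dist_add_one hne
  refine ⟨w, ?_, hadj, by omega⟩
  by_cases hw : ρ = w
  · subst hw
    exact hρ
  · obtain ⟨w', hadj', hd'⟩ := hG.exists_adj_dist_add_one hw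
    have hne' : v ≠ w' := by
      rintro rfl
      omega
    have : 1 < (G.neighborFinset w).card := Finset.one_lt_card.2
      ⟨v, by simpa using hadj, w', by simpa using hadj'.symm, hne'⟩
    rw [card_neighborFinset_eq_degree] at this
    exact this.ne'

/-- Deleting the leaves of a connected graph leaves a connected graph. -/
theorem Connected.induce_degree_ne_one {V : Type*} [Fintype V] {G : SimpleGraph V}
    [DecidableRel G.Adj] (hG : G.Connected) {ρ : V} (hρ : G.degree ρ ≠ 1) :
    (G.induce {v | G.degree v ≠ 1}).Connected :=
  induce_connected_of_forall_exists_closer G _ ρ hρ fun _ _ hwρ =>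
    hG.exists_adj_degree_ne_one hρ (Ne.symm hwρ)

/-- In a tree of order at least two without vertices of degree two, fewer than half of the
vertices are inner vertices. -/
theorem IsTree.two_mul_card_degree_ne_one_add_two_le {V : Type*} [Fintype V] {T : SimpleGraph V}
    [DecidableRel T.Adj] (hT : T.IsTree) (hdeg : ∀ v, T.degree v ≠ 2) (h2 : 1 < Fintype.card V) :
    2 * Fintype.card {v | T.degree v ≠ 1} + 2 ≤ Fintype.card V := by
  classical
  have : Nontrivial V := Fintype.one_lt_card_iff_nontrivial.1 h2
  have h3 := T.sum_degrees_eq_twice_card_edges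
  have h4 := hT.card_edgeFinset
  have e : Fintype.card {v | T.degree v ≠ 1} = ∑ v, if T.degree v ≠ 1 then 1 else 0 := by
    rw [Finset.sum_boole, Nat.cast_id]
    exact Fintype.card_subtype _
  have e2 : Fintype.card V = ∑ _v : V, 1 := by simp
  -- Inner vertices have degree at least three.
  have h5 : Fintype.card V + 2 * Fintype.card {v | T.degree v ≠ 1} ≤ ∑ v, T.degree v := by
    rw [e, e2, Finset.mul_sum, ← Finset.sum_add_distrib]
    refine Finset.sum_le_sum fun v _ => ?_
    have h6 := hT.connected.preconnected.degree_pos_of_nontrivial v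
    have h7 := hdeg v
    split_ifs <;> omega
  omega

theorem IsTree.burningNumber_le_of_forall_degree_ne_two {V : Type*} [Fintype V]
    {T : SimpleGraph V} [DecidableRel T.Adj] (hT : T.IsTree) (hdeg : ∀ v, T.degree v ≠ 2) {k : ℕ}
    (hk : Fintype.card V + 1 ≤ k * (k + 1)) : T.burningNumber ≤ k := by
  classical
  have hG := hT.connected
  obtain ⟨k, rfl⟩ : ∃ j, k = j + 1 := ⟨k - 1, by rcases k with _ | k <;> simp_all⟩
  by_cases hsmall : Fintype.card V ≤ 2 * k + 1
  · obtain ⟨c, hc⟩ := hG.exists_forall_dist_le hsmall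
    exact hG.burningNumber_le_of_ball_cover (fun _ => c) fun v => ⟨k, by omega, hc v⟩
  obtain ⟨k, rfl⟩ : ∃ j, k = j + 1 := ⟨k - 1, by rcases k with _ | k <;> simp_all⟩
  have hin := hT.two_mul_card_degree_ne_one_add_two_le hdeg (by omega)
  obtain ⟨ρ, hρ⟩ : ∃ ρ, T.degree ρ ≠ 1 := by
    by_contra! hall
    have h3 := T.sum_degrees_eq_twice_card_edges
    have h4 := hT.card_edgeFinset
    simp only [hall, Finset.sum_const, Finset.card_univ, smul_eq_mul, mul_one] at h3
    omega
  have hconn := hG.induce_degree_ne_one hρ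
  -- The counts miss the bound of `exists_ball_cover` by one; parity of `k * (k + 1)` closes the
  -- gap.
  obtain ⟨a, ha⟩ := Nat.even_mul_succ_self k
  rw [show (k + 1 + 1) * (k + 1 + 1 + 1) = k * (k + 1) + 4 * k + 6 by ring] at hk
  obtain ⟨c, z, hcz⟩ := hconn.exists_ball_cover k k (by omega)
  have hcov : ∀ w, T.degree w ≠ 1 → ∃ i < k + 1,
      T.dist (if i = k then z else c i : {v | T.degree v ≠ 1}) w ≤ i := by
    intro w hw
    obtain h1 | ⟨i, hi, h1⟩ := hcz ⟨w, hw⟩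
    · refine ⟨k, by omega, ?_⟩
      rw [if_pos rfl]
      exact (dist_le_dist_induce hconn z ⟨w, hw⟩).trans h1
    · refine ⟨i, by omega, ?_⟩
      rw [if_neg (by omega)]
      exact (dist_le_dist_induce hconn _ ⟨w, hw⟩).trans h1
  refine hG.burningNumber_le_of_ball_cover
    -- Radii shift up by one; the ball of radius `0` is not needed.
    (fun i => (if i - 1 = k then z else c (i - 1) : {v | T.degree v ≠ 1})) fun v => ?_
  by_cases hv : T.degree v = 1
  · obtain ⟨w, hw, hadj, -⟩ := hG.exists_adj_degree_ne_one hρ (v := v) fun h => hρ (h ▸ hv)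
    obtain ⟨i, hi, hd⟩ := hcov w hw
    refine ⟨i + 1, by omega, ?_⟩
    rw [Nat.add_sub_cancel]
    exact (hG.dist_le_add_one_of_adj _ hadj).trans (by omega)
  · obtain ⟨i, hi, hd⟩ := hcov v hv
    refine ⟨i + 1, by omega, ?_⟩
    rw [Nat.add_sub_cancel]
    omega

end SimpleGraph

theorem mainTheorem2 {V : Type*} [Fintype V] (T : SimpleGraph V) [DecidableRel T.Adj]
    (hT : T.IsTree) (hdeg : ∀ v : V, T.degree v ≠ 2) (n m : ℕ) (hcard : Fintype.card V = n)
    (hn : m * (m + 1) + 1 ≤ n) :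
    T.burningNumber ≤ ⌈((n : ℝ) - (m : ℝ)) ^ (1 / 2 : ℝ)⌉₊ := by
  set k := ⌈((n : ℝ) - (m : ℝ)) ^ (1 / 2 : ℝ)⌉₊ with hk
  have h1 : ((n : ℝ) - (m : ℝ)) ^ (1 / 2 : ℝ) ≤ k := Nat.le_ceil _
  rw [← Real.sqrt_eq_rpow] at h1
  have h2 : (n : ℝ) - m ≤ (k : ℝ) ^ 2 := (Real.sqrt_le_left (Nat.cast_nonneg k)).1 h1
  have h3 : n ≤ k ^ 2 + m := by
    have : (n : ℝ) ≤ ((k ^ 2 + m : ℕ) : ℝ) := by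
      push_cast
      linarith
    exact_mod_cast this
  -- Otherwise `n ≤ k ^ 2 + m ≤ m * (m + 1)`.
  have h4 : m < k := by
    by_contra! h
    nlinarith
  exact hT.burningNumber_le_of_forall_degree_ne_two hdeg (by nlinarith)
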